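/- Let $\xi_1,\xi_2,\dots$ be independent identically distributed real random variables with distribution function $F$, and write $\overline F(x)=1-F(x)$, $\hat F(\gamma)=\mathbf E e^{\gamma\xi_1}$. Put $S_0=0$, $S_n=\xi_1+\dots+\xi_n$, $M_n=\max_{0\le i\le n}S_i$, $M=\sup_{n\ge0}S_n$, and, for $n\ge1$ and $x\ge a\ge0$, $A_n^{a,x}=\{M_{n-1}\le a,\ S_n>x\}$. Let $\gamma>0$ and suppose that $F\in\mathcal S_\gamma$, i.e. $\overline F(x)>0$ for all $x$; $\overline F(x-k)/\overline F(x)\to e^{\gamma k}$ as $x\to\infty$ for every fixed real $k$; $\hat F(\gamma)<\infty$; and $\overline{F*F}(x)\sim 2\hat F(\gamma)\overline F(x)$ as $x\to\infty$. Suppose moreover that $\hat F(\gamma)<1$. Let $h$ be any function with $0<h(x)\le x/2$ for all $x>0$ and $h(x)\to\infty$ as $x\to\infty$. **Theorem.** $\mathbf E e^{\gamma M}<\infty$, and for every fixed $t>0$, $$\lim_{x\to\infty}\frac{1}{\overline F(x)}\mathbf P\Bigl(M\in(x,x+t],\ \bigcup_{n\ge1}A_n^{h(x),x-h(x)}\Bigr)=\lim_{x\to\infty}\frac{\mathbf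 P(M\in(x,x+t])}{\overline F(x)}=\frac{\mathbf E e^{\gamma M}}{1-\hat F(\gamma)}\bigl(1-e^{-\gamma t}\bigr).$$ Moreover, for every $t_0>0$, both convergences are uniform in $t\in[t_0,\infty]$, where for $t=\infty$ the event $\{M\in(x,x+t]\}$ is $\{M>x\}$ and $e^{-\gamma t}=0$. -/

import Mathlib

open MeasureTheory ProbabilityTheory Filter Topology Set
open scoped ENNReal

noncomputable section

namespace BigJump

/-! A distribution function on the real line is represented by the corresponding
probability measure `F` on `ℝ`. -/

/-- The tail `F̄(x) = 1 - F(x) = F((x, ∞))`. -/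
def tail (F : Measure ℝ) (x : ℝ) : ℝ := F.real (Ioi x)

/-- The exponential moment `φ_F(α) = ∫ e^{α x} dF(x)`, with values in `[0, ∞]`. -/
def expMoment (F : Measure ℝ) (α : ℝ) : ℝ≥0∞ := ∫⁻ x, ENNReal.ofReal (Real.exp (α * x)) ∂F

/-- The class `𝓛_γ`: everywhere positive tail and `F̄(x - k) / F̄(x) → e^{γ k}` for each fixed
real `k`. -/
structure ClassL (γ : ℝ) (F : Measure ℝ) : Prop where
  tail_pos : ∀ x, 0 < tail F x
  tendsto_ratio : ∀ k : ℝ,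
    Tendsto (fun x => tail F (x - k) / tail F x) atTop (𝓝 (Real.exp (γ * k)))

/-- The class `𝓢_γ`: `F ∈ 𝓛_γ`, `φ_F(γ) < ∞`, and the tail of the convolution `F * F` is
asymptotically equivalent to `2 φ_F(γ) F̄`. -/
structure ClassS (γ : ℝ) (F : Measure ℝ) : Prop extends ClassL γ F where
  expMoment_lt_top : expMoment F γ < ∞
  tail_conv : Tendsto
    (fun x => tail (Measure.conv F F) x / (2 * (expMoment F γ).toReal * tail F x)) atTop (𝓝 1)

variable {Ω : Type*}

/-- The random walk `S_0 = 0`, `S_n = ξ_1 + ⋯ + ξ_n`; the increment `ξ_{i+1}` is `ξ i`. -/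
def walk (ξ : ℕ → Ω → ℝ) (n : ℕ) (ω : Ω) : ℝ := ∑ i ∈ Finset.range n, ξ i ω

/-- The running maximum `M_n = max_{0 ≤ i ≤ n} S_i`. -/
def runMax (ξ : ℕ → Ω → ℝ) (n : ℕ) (ω : Ω) : ℝ :=
  (Finset.range (n + 1)).sup' Finset.nonempty_range_add_one (fun i => walk ξ i ω)

/-- The global maximum `M = sup_{n ≥ 0} S_n`, a priori with values in `[0, ∞]`. -/
def globalMax (ξ : ℕ → Ω → ℝ) (ω : Ω) : EReal := ⨆ n : ℕ, (walk ξ n ω : EReal)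

/-- The event `A_n^{a,x} = {M_{n-1} ≤ a, S_n > x}`, used for `n ≥ 1`. -/
def jumpEvent (ξ : ℕ → Ω → ℝ) (n : ℕ) (a x : ℝ) : Set Ω :=
  {ω | runMax ξ (n - 1) ω ≤ a ∧ x < walk ξ n ω}

/-- The event `⋃_{n ≥ 1} A_n^{a,x}`. -/
def someJump (ξ : ℕ → Ω → ℝ) (a x : ℝ) : Set Ω := ⋃ (n : ℕ) (_ : 1 ≤ n), jumpEvent ξ n a x

/-- The event `M ∈ (x, x + t]`, where `t` may be `∞` (and then it is the event `M > x`). -/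
def localEvent (ξ : ℕ → Ω → ℝ) (x : ℝ) (t : EReal) : Set Ω :=
  {ω | globalMax ξ ω ∈ Ioc (x : EReal) ((x : EReal) + t)}

variable [MeasurableSpace Ω]

/-- `E e^{γ M}`, with values in `[0, ∞]`. -/
def expMax (P : Measure Ω) (ξ : ℕ → Ω → ℝ) (γ : ℝ) : ℝ≥0∞ :=
  ∫⁻ ω, EReal.exp ((γ : EReal) * globalMax ξ ω) ∂P

end BigJump

end

namespace BigJump

/-! Write `φ` for the exponential moment of `F` at `γ` and `C = E e^{γM} / (1 - φ)`. It suffices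
that `P(M > x)` and `P(M > x, ⋃ A_n)` are both `~ C F̄(x)`. The first event contains the second, so
an upper bound for the first and a lower bound for the second are enough.

Upper bound: `M` has the law of `max(0, M + ξ)` with `ξ` independent of `M`. When `M + ξ > x`,
either `M ≤ K`, which contributes at most about `E e^{γM} F̄(x)`, or `M > K`. In the latter case the
tail of `M` may be replaced by `L F̄`, and `𝓢_γ` makes the contribution about `φ L F̄(x)`. Hence the
limsup `L` of `P(M > x) / F̄(x)` satisfies `L ≤ E e^{γM} + φ L`, that is `L ≤ C`, once `L` is known
to be finite. Finiteness comes from the same splitting applied to the `M_n`, where `φ < 1` makes the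
induction close (`ClassS.exists_tail_le_of_recursion`, `ClassS.eventually_tail_lt_of_fixedPoint`).

Lower bound: let `ξ_{n+1}` be the big jump, with the past maximum and the future maximum `M'` at
most `K`. These events are disjoint, and the `n`-th has probability about `E[e^{γ(S_n + M')};
bounded] F̄(x)`. As `K → ∞` the constant tends to `φ^n E e^{γM}`, and summing over `n` gives `C`
(`ClassS.eventually_lt_measureReal_someJump`).

The local statement is the difference of two tails, and uniformity in `t` follows from monotonicity.
-/

/-! ### Tails, convolutions and the class `𝓢_γ`. -/

lemma tail_nonneg (F : Measure ℝ) (x : ℝ) : 0 ≤ tail F x := measureReal_nonneg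

lemma tail_antitone (F : Measure ℝ) [IsFiniteMeasure F] : Antitone (tail F) :=
  fun _ _ h => measureReal_mono (Ioi_subset_Ioi h)

lemma tail_le_one (F : Measure ℝ) [IsProbabilityMeasure F] (x : ℝ) : tail F x ≤ 1 :=
  measureReal_le_one

lemma measurable_tail (F : Measure ℝ) [IsFiniteMeasure F] : Measurable (tail F) :=
  (tail_antitone F).measurable

lemma measurable_measure_Ioi {α : Type*} [MeasurableSpace α] (F : Measure ℝ) {w : α → ℝ}
    (hw : Measurable w) : Measurable fun a => F (Ioi (w a)) :=
  (show Antitone fun x : ℝ => F (Ioi x) from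
    fun _ _ h => measure_mono (Ioi_subset_Ioi h)).measurable.comp hw

lemma integrable_tail_comp {α : Type*} [MeasurableSpace α] (ν : Measure α) [IsFiniteMeasure ν]
    (F : Measure ℝ) [IsProbabilityMeasure F] {W : α → ℝ} (hW : AEMeasurable W ν) :
    Integrable (fun a => tail F (W a)) ν := by
  refine Integrable.of_bound ((measurable_tail F).comp_aemeasurable hW).aestronglyMeasurable 1
    (ae_of_all _ fun a => ?_)
  rw [Real.norm_of_nonneg (tail_nonneg _ _)]
  exact tail_le_one _ _

/-- Dominated convergence for the class `𝓛_γ`: the tail averaged over a shift bounded above. -/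
lemma ClassL.tendsto_integral_tail {γ : ℝ} {F : Measure ℝ} [IsProbabilityMeasure F]
    (hF : ClassL γ F) {α : Type*} [MeasurableSpace α] (ν : Measure α) [IsFiniteMeasure ν]
    {W : α → ℝ} (hW : AEMeasurable W ν) {K : ℝ} (hK : ∀ᵐ a ∂ν, W a ≤ K) :
    Tendsto (fun x => (∫ a, tail F (x - W a) ∂ν) / tail F x) atTop
      (𝓝 (∫ a, Real.exp (γ * W a) ∂ν)) := by
  simp_rw [← integral_div]
  refine tendsto_integral_filter_of_dominated_convergence
    (fun _ => Real.exp (γ * K) + 1) ?_ ?_ (integrable_const _) ?_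
  · exact Eventually.of_forall fun x =>
      ((integrable_tail_comp ν F (hW.const_sub x)).div_const _).aestronglyMeasurable
  · filter_upwards [(hF.tendsto_ratio K).eventually_lt_const (lt_add_one _)] with x hx
    filter_upwards [hK] with a ha
    rw [Real.norm_of_nonneg (div_nonneg (tail_nonneg _ _) (tail_nonneg _ _))]
    refine le_trans ?_ hx.le
    have := hF.tail_pos x
    gcongr
    exact tail_antitone F (by linarith)
  · exact ae_of_all _ fun a => hF.tendsto_ratio (W a)

/-- The tail of a sum, split according to the size of the first summand. -/
lemma integral_tail_sub_eq_add (G F : Measure ℝ) [IsProbabilityMeasure G] [IsProbabilityMeasure F]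
    (x K : ℝ) : ∫ y, tail F (x - y) ∂G
      = (∫ y in Iic K, tail F (x - y) ∂G) + ∫ z, tail G (max K (x - z)) ∂F := by
  have hi : Integrable (fun y => tail F (x - y)) G :=
    integrable_tail_comp G F (measurable_const.sub measurable_id).aemeasurable
  rw [← integral_add_compl measurableSet_Iic hi (s := Iic K), compl_Iic]
  congr 1
  -- The part with first summand above `K` is the product measure of this set, sliced along either
  -- coordinate.
  have hA : MeasurableSet {p : ℝ × ℝ | K < p.1 ∧ x < p.1 + p.2} :=
    (measurableSet_lt measurable_const measurable_fst).inter
      (measurableSet_lt measurable_const (measurable_fst.add measurable_snd))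
  have h1 := Measure.prod_apply (μ := G) (ν := F) hA
  rw [Measure.prod_apply_symm hA] at h1
  have e1 : ∀ y : ℝ, F (Prod.mk y ⁻¹' {p : ℝ × ℝ | K < p.1 ∧ x < p.1 + p.2})
      = (Ioi K).indicator (fun y => F (Ioi (x - y))) y := by
    intro y
    by_cases hy : K < y
    · rw [indicator_of_mem (by exact hy)]
      congr 1
      ext z
      simp [hy, sub_lt_iff_lt_add']
    · rw [indicator_of_notMem (by exact hy)]
      convert measure_empty (μ := F)
      ext z
      simp [hy]
  have e2 : ∀ z : ℝ, G ((fun y => (y, z)) ⁻¹' {p : ℝ × ℝ | K < p.1 ∧ x < p.1 + p.2})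
      = G (Ioi (max K (x - z))) := by
    intro z
    congr 1
    ext y
    simp [sub_lt_iff_lt_add]
  simp_rw [e1, e2] at h1
  rw [lintegral_indicator measurableSet_Ioi] at h1
  unfold tail Measure.real
  rw [integral_toReal, integral_toReal, h1]
  · exact (measurable_measure_Ioi G (by fun_prop)).aemeasurable
  · exact ae_of_all _ fun z => measure_lt_top _ _
  · exact (measurable_measure_Ioi F (by fun_prop)).aemeasurable
  · exact ae_of_all _ fun z => measure_lt_top _ _

lemma tail_conv_eq_integral (G F : Measure ℝ) [IsProbabilityMeasure G] [IsProbabilityMeasure F]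
    (x : ℝ) : tail (Measure.conv G F) x = ∫ y, tail F (x - y) ∂G := by
  unfold tail Measure.real
  rw [integral_toReal, Measure.conv, Measure.map_apply (by fun_prop) measurableSet_Ioi,
    Measure.prod_apply ((by fun_prop : Measurable fun p : ℝ × ℝ => p.1 + p.2) measurableSet_Ioi)]
  · congr 2
    ext y
    congr 1
    ext z
    simp [sub_lt_iff_lt_add']
  · exact (measurable_measure_Ioi F (by fun_prop)).aemeasurable
  · exact ae_of_all _ fun z => measure_lt_top _ _

lemma integrable_exp_of_expMoment_lt_top {γ : ℝ} {F : Measure ℝ} (h : expMoment F γ < ∞) :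
    Integrable (fun x => Real.exp (γ * x)) F := by
  refine ⟨by fun_prop, ?_⟩
  rw [hasFiniteIntegral_iff_ofReal (ae_of_all _ fun _ => (Real.exp_pos _).le)]
  exact h

lemma toReal_expMoment (γ : ℝ) (F : Measure ℝ) :
    (expMoment F γ).toReal = ∫ x, Real.exp (γ * x) ∂F := by
  rw [integral_eq_lintegral_of_nonneg_ae (ae_of_all _ fun _ => (Real.exp_pos _).le) (by fun_prop),
    expMoment]

lemma tendsto_setIntegral_Iic {G : Measure ℝ} {f : ℝ → ℝ} (hf : Integrable f G) :
    Tendsto (fun K => ∫ x in Iic K, f x ∂G) atTop (𝓝 (∫ x, f x ∂G)) :=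
  (aecover_Iic tendsto_id).integral_tendsto_of_countably_generated hf

/-- `P(ξ' > K, ξ + ξ' > x)` for independent `ξ, ξ'` with law `F`. -/
noncomputable def bigPart (F : Measure ℝ) (K x : ℝ) : ℝ := ∫ z, tail F (max K (x - z)) ∂F

/-- The convolution condition gives the full tail, and dominated convergence removes the part with
first summand at most `K`. The limit decreases to `φ` as `K → ∞`. -/
lemma ClassS.tendsto_bigPart {γ : ℝ} {F : Measure ℝ} [IsProbabilityMeasure F]
    (hS : ClassS γ F) (K : ℝ) :
    Tendsto (fun x => bigPart F K x / tail F x) atTop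
      (𝓝 (2 * (expMoment F γ).toReal - ∫ y in Iic K, Real.exp (γ * y) ∂F)) := by
  have hpos : 0 < (expMoment F γ).toReal := by
    rw [toReal_expMoment]
    exact integral_exp_pos (integrable_exp_of_expMoment_lt_top hS.expMoment_lt_top)
  have h1 := hS.tendsto_integral_tail (F.restrict (Iic K)) (W := fun y => y)
    aemeasurable_id (K := K) (ae_restrict_mem measurableSet_Iic)
  have h2 := (hS.tail_conv.mul_const (2 * (expMoment F γ).toReal)).sub h1
  rw [one_mul] at h2
  refine h2.congr fun x => ?_
  have hx := hS.tail_pos x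
  rw [tail_conv_eq_integral, integral_tail_sub_eq_add F F x K, bigPart]
  field_simp
  ring

/-- A tail bound for `G` beyond `K` passes to the convolution `G * F`. -/
lemma tail_conv_le {G F : Measure ℝ} [IsProbabilityMeasure G] [IsProbabilityMeasure F]
    {B K : ℝ} (hB : ∀ y, K ≤ y → tail G y ≤ B * tail F y) (x : ℝ) :
    tail (Measure.conv G F) x
      ≤ (∫ y in Iic K, tail F (x - y) ∂G) + B * bigPart F K x := by
  rw [tail_conv_eq_integral, integral_tail_sub_eq_add G F x K, bigPart, ← integral_const_mul]
  gcongr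
  · exact integrable_tail_comp F G (by fun_prop)
  · exact (integrable_tail_comp F F (by fun_prop)).const_mul _
  · exact fun z => hB _ (le_max_left _ _)

lemma ClassS.exists_bigPart_le {γ : ℝ} {F : Measure ℝ} [IsProbabilityMeasure F]
    (hS : ClassS γ F) {ρ : ℝ} (hρ : (expMoment F γ).toReal < ρ) :
    ∀ᶠ K in atTop, ∀ᶠ x in atTop, bigPart F K x ≤ ρ * tail F x := by
  have h1 := (tendsto_setIntegral_Iic
    (integrable_exp_of_expMoment_lt_top hS.expMoment_lt_top)).const_sub
      (2 * (expMoment F γ).toReal)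
  rw [← toReal_expMoment] at h1
  filter_upwards [h1.eventually_lt_const (by linarith : _ < ρ)] with K hK
  filter_upwards [(hS.tendsto_bigPart K).eventually_lt_const hK] with x hx
  exact ((div_lt_iff₀ (hS.tail_pos x)).1 hx).le

/-! ### Tail bounds from the Lindley recursion. -/

/-- Uniform bound for the tails of a sequence of laws obeying the Lindley recursion. -/
lemma ClassS.exists_tail_le_of_recursion {γ : ℝ} {F : Measure ℝ} [IsProbabilityMeasure F]
    (hS : ClassS γ F) (hφ : expMoment F γ < 1) (G : ℕ → Measure ℝ)
    [∀ n, IsProbabilityMeasure (G n)] (h0 : ∀ x, 0 ≤ x → tail (G 0) x = 0)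
    (hrec : ∀ n x, 0 ≤ x → tail (G (n + 1)) x = tail (Measure.conv (G n) F) x) :
    ∃ B, 0 ≤ B ∧ ∀ n x, 0 ≤ x → tail (G n) x ≤ B * tail F x := by
  have hφ' : (expMoment F γ).toReal < 1 := by
    simpa using (ENNReal.toReal_lt_toReal hφ.ne_top ENNReal.one_ne_top).2 hφ
  obtain ⟨ρ, hρ1, hρ2⟩ := exists_between hφ'
  have hρ0 : 0 ≤ ρ := ENNReal.toReal_nonneg.trans hρ1.le
  obtain ⟨K, hK, hK0⟩ := ((hS.exists_bigPart_le hρ1).and (eventually_ge_atTop 0)).exists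
  obtain ⟨x₀, hx₀⟩ := (hK.and ((hS.tendsto_ratio K).eventually_lt_const
    (lt_add_one _))).exists_forall_of_atTop
  -- The first entry gives `D F̄(x) ≥ 1` for `x ≤ x₀`; the second controls the part with `G n` at
  -- most `K` for `x ≥ x₀`. The final constant `B = D / (1 - ρ)` solves `D + ρ B = B`.
  set D : ℝ := max (1 / tail F x₀) (Real.exp (γ * K) + 1)
  have hD : 0 ≤ D := le_max_of_le_right (by positivity)
  have hB0 : 0 ≤ D / (1 - ρ) := div_nonneg hD (by linarith)
  have hBD : D + D / (1 - ρ) * ρ = D / (1 - ρ) := by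
    have : 1 - ρ ≠ 0 := by linarith
    field_simp
    ring
  refine ⟨D / (1 - ρ), hB0, fun n => ?_⟩
  induction n with
  | zero => exact fun x hx => by rw [h0 x hx]; exact mul_nonneg hB0 (tail_nonneg _ _)
  | succ n ih =>
    intro x hx
    rw [hrec n x hx]
    rcases le_total x x₀ with h | h
    · have h1 : 1 ≤ D * tail F x₀ := by
        rw [← div_le_iff₀ (hS.tail_pos x₀)]
        exact le_max_left _ _
      calc tail (Measure.conv (G n) F) x ≤ 1 := tail_le_one _ _
        _ ≤ D * tail F x₀ := h1
        _ ≤ D * tail F x := by gcongr; exact tail_antitone F h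
        _ ≤ _ := by
          gcongr
          · exact tail_nonneg _ _
          · rw [← hBD]
            exact le_add_of_nonneg_right (mul_nonneg hB0 hρ0)
    · obtain ⟨h1, h2⟩ := hx₀ x h
      rw [div_lt_iff₀ (hS.tail_pos x)] at h2
      have h3 : ∫ y in Iic K, tail F (x - y) ∂(G n) ≤ D * tail F x := by
        calc ∫ y in Iic K, tail F (x - y) ∂(G n) ≤ ∫ y in Iic K, tail F (x - K) ∂(G n) := by
              refine setIntegral_mono_on ?_ (integrable_const _).integrableOn measurableSet_Iic
                fun y hy => tail_antitone F (by linarith [mem_Iic.1 hy])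
              exact (integrable_tail_comp _ F (by fun_prop)).integrableOn
          _ = (G n).real (Iic K) * tail F (x - K) := by simp
          _ ≤ 1 * tail F (x - K) := by
              gcongr
              · exact tail_nonneg _ _
              · exact measureReal_le_one
          _ ≤ (Real.exp (γ * K) + 1) * tail F x := by rw [one_mul]; exact h2.le
          _ ≤ D * tail F x := by
              gcongr
              · exact tail_nonneg _ _
              · exact le_max_right _ _
      calc _ ≤ _ := tail_conv_le (fun y hy => ih y (hK0.trans hy)) x
        _ ≤ D * tail F x + D / (1 - ρ) * (ρ * tail F x) := by gcongr
        _ = (D + D / (1 - ρ) * ρ) * tail F x := by ring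
        _ = _ := by rw [hBD]

/-- Asymptotic upper bound for the tail of a fixed point of the Lindley recursion. -/
lemma ClassS.eventually_tail_lt_of_fixedPoint {γ : ℝ} {F : Measure ℝ} [IsProbabilityMeasure F]
    (hS : ClassS γ F) (hφ : expMoment F γ < 1) {G : Measure ℝ} [IsProbabilityMeasure G]
    (hfix : ∀ x, 0 ≤ x → tail G x = tail (Measure.conv G F) x)
    {B : ℝ} (hB0 : 0 ≤ B) (hB : ∀ x, 0 ≤ x → tail G x ≤ B * tail F x)
    (hint : Integrable (fun x => Real.exp (γ * x)) G) {c : ℝ}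
    (hc : (∫ x, Real.exp (γ * x) ∂G) / (1 - (expMoment F γ).toReal) < c) :
    ∀ᶠ x in atTop, tail G x < c * tail F x := by
  have hφ' : (expMoment F γ).toReal < 1 := by
    simpa using (ENNReal.toReal_lt_toReal hφ.ne_top ENNReal.one_ne_top).2 hφ
  have hpos : 0 < (expMoment F γ).toReal := by
    rw [toReal_expMoment]
    exact integral_exp_pos (integrable_exp_of_expMoment_lt_top hS.expMoment_lt_top)
  set φ := (expMoment F γ).toReal
  set m := ∫ x, Real.exp (γ * x) ∂G
  -- The infimum of `S` plays the role of the limsup of the tail ratio; the a priori bound `B` makes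
  -- `S` nonempty.
  let S : Set ℝ := {L | 0 ≤ L ∧ ∀ᶠ x in atTop, tail G x ≤ L * tail F x}
  have hSne : S.Nonempty := ⟨B, hB0, by
    filter_upwards [eventually_ge_atTop 0] with x hx using hB x hx⟩
  have hSbdd : BddBelow S := ⟨0, fun L hL => hL.1⟩
  have hm : 0 ≤ m := integral_nonneg fun _ => (Real.exp_pos _).le
  have hstep : ∀ L ∈ S, sInf S ≤ m + φ * L := by
    intro L hL
    refine le_of_forall_pos_le_add fun ε hε => csInf_le hSbdd ⟨by have := hL.1; positivity, ?_⟩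
    have hL1 : 0 < L + 1 := by linarith [hL.1]
    -- The increment is multiplied by `L` below and must then cost at most `ε / 2`; dividing by `L +
    -- 1` covers `L = 0`.
    have hδ : φ < φ + ε / 2 / (L + 1) := by
      have : 0 < ε / 2 / (L + 1) := by positivity
      linarith
    obtain ⟨y₀, hy₀⟩ := hL.2.exists_forall_of_atTop
    obtain ⟨K, hK, hKy⟩ := ((hS.exists_bigPart_le hδ).and (eventually_ge_atTop y₀)).exists
    have h1 := hS.tendsto_integral_tail (G.restrict (Iic K)) (W := fun y => y)
      aemeasurable_id (K := K) (ae_restrict_mem measurableSet_Iic)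
    have h2 : ∫ y in Iic K, Real.exp (γ * y) ∂G < m + ε / 2 := by
      have : ∫ y in Iic K, Real.exp (γ * y) ∂G ≤ m :=
        setIntegral_le_integral hint (ae_of_all _ fun _ => (Real.exp_pos _).le)
      linarith
    filter_upwards [hK, h1.eventually_lt_const h2, eventually_ge_atTop 0] with x hx1 hx2 hx0
    rw [div_lt_iff₀ (hS.tail_pos x)] at hx2
    have hFx := tail_nonneg F x
    calc tail G x = tail (Measure.conv G F) x := hfix x hx0
      _ ≤ _ := tail_conv_le (fun y hy => hy₀ y (hKy.trans hy)) x
      _ ≤ (m + ε / 2) * tail F x + L * ((φ + ε / 2 / (L + 1)) * tail F x) := by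
          have := hL.1
          gcongr
      _ = (m + φ * L + (ε / 2 + ε / 2 * (L / (L + 1)))) * tail F x := by ring
      _ ≤ (m + φ * L + ε) * tail F x := by
          have : L / (L + 1) ≤ 1 := (div_le_one hL1).2 (by linarith)
          have h3 : ε / 2 * (L / (L + 1)) ≤ ε / 2 * 1 := by gcongr
          gcongr
          linarith
  -- Taking the infimum over `L` in `hstep` gives `sInf S ≤ m + φ * sInf S`.
  have h1 : (sInf S - m) / φ ≤ sInf S := by
    refine le_csInf hSne fun L hL => ?_
    rw [div_le_iff₀ hpos]
    linarith [hstep L hL, mul_comm φ L]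
  have h2 : sInf S ≤ m / (1 - φ) := by
    rw [div_le_iff₀ hpos] at h1
    rw [le_div_iff₀ (by linarith)]
    linarith
  obtain ⟨L, hL, hLc⟩ := exists_lt_of_csInf_lt hSne (h2.trans_lt hc)
  filter_upwards [hL.2] with x hx
  exact hx.trans_lt (mul_lt_mul_of_pos_right hLc (hS.tail_pos x))

/-! ### Pathwise properties of the walk and its maxima. -/

section Paths

variable {Ω : Type*} (ξ : ℕ → Ω → ℝ)

@[simp] lemma walk_zero (ω : Ω) : walk ξ 0 ω = 0 := by simp [walk]

lemma walk_succ' (n : ℕ) (ω : Ω) :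
    walk ξ (n + 1) ω = walk (fun i => ξ (i + 1)) n ω + ξ 0 ω := by
  simp [walk, Finset.sum_range_succ']

lemma walk_succ (n : ℕ) (ω : Ω) : walk ξ (n + 1) ω = walk ξ n ω + ξ n ω := by
  simp [walk, Finset.sum_range_succ]

lemma walk_add (n k : ℕ) (ω : Ω) :
    walk ξ (n + k) ω = walk ξ n ω + walk (fun i => ξ (n + i)) k ω := by
  simp [walk, Finset.sum_range_add]

lemma lt_runMax_iff (n : ℕ) (x : ℝ) (ω : Ω) :
    x < runMax ξ n ω ↔ ∃ i ≤ n, x < walk ξ i ω := by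
  simp [runMax, Finset.lt_sup'_iff]

lemma runMax_le_iff (n : ℕ) (x : ℝ) (ω : Ω) :
    runMax ξ n ω ≤ x ↔ ∀ i ≤ n, walk ξ i ω ≤ x := by
  simp [runMax, Finset.sup'_le_iff]

lemma lt_globalMax_iff (x : ℝ) (ω : Ω) :
    (x : EReal) < globalMax ξ ω ↔ ∃ n, x < walk ξ n ω := by
  simp [globalMax, lt_iSup_iff]

lemma globalMax_nonneg (ξ : ℕ → Ω → ℝ) (ω : Ω) : 0 ≤ globalMax ξ ω :=
  le_iSup_of_le 0 (by simp)

/-- Since `x ≥ 0`, the value `S_0 = 0` cannot exceed `x`, so the first increment can be split off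
every relevant `S_i`. -/
lemma lt_runMax_succ_iff (n : ℕ) {x : ℝ} (hx : 0 ≤ x) (ω : Ω) :
    x < runMax ξ (n + 1) ω ↔ x < runMax (fun i => ξ (i + 1)) n ω + ξ 0 ω := by
  rw [← sub_lt_iff_lt_add, lt_runMax_iff, lt_runMax_iff]
  constructor
  · rintro ⟨i, hi, h⟩
    cases i with
    | zero => simp at h; linarith
    | succ i => exact ⟨i, by omega, by rw [walk_succ'] at h; linarith⟩
  · rintro ⟨i, hi, h⟩
    exact ⟨i + 1, by omega, by rw [walk_succ']; linarith⟩

lemma walk_congr {ξ' : ℕ → Ω → ℝ} {n : ℕ} {ω : Ω} (h : ∀ i < n, ξ i ω = ξ' i ω) :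
    walk ξ n ω = walk ξ' n ω :=
  Finset.sum_congr rfl fun i hi => h i (Finset.mem_range.1 hi)

lemma runMax_congr {ξ' : ℕ → Ω → ℝ} {n : ℕ} {ω : Ω} (h : ∀ i < n, ξ i ω = ξ' i ω) :
    runMax ξ n ω = runMax ξ' n ω := by
  refine eq_of_forall_ge_iff fun x => ?_
  rw [runMax_le_iff, runMax_le_iff]
  refine forall₂_congr fun i hi => ?_
  rw [walk_congr ξ fun j hj => h j (by omega)]

lemma globalMax_congr {ξ' : ℕ → Ω → ℝ} {ω : Ω} (h : ∀ i, ξ i ω = ξ' i ω) :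
    globalMax ξ ω = globalMax ξ' ω :=
  iSup_congr fun n => by rw [walk_congr ξ fun i _ => h i]

/-- A supremum of nonnegative terms is at most their sum. Passing to `log s / γ` in `EReal` also
covers an infinite maximum. -/
lemma exp_mul_globalMax_le {γ : ℝ} (hγ : 0 < γ) (ω : Ω) :
    EReal.exp (γ * globalMax ξ ω) ≤ ∑' n, ENNReal.ofReal (Real.exp (γ * walk ξ n ω)) := by
  set s := ∑' n, ENNReal.ofReal (Real.exp (γ * walk ξ n ω)) with hs
  have hγ' : (0 : EReal) < γ := by exact_mod_cast hγ
  rw [← ENNReal.exp_log s, EReal.exp_le_exp_iff, mul_comm,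
    ← EReal.le_div_iff_mul_le hγ' (EReal.coe_ne_top γ)]
  refine iSup_le fun n => ?_
  rw [EReal.le_div_iff_mul_le hγ' (EReal.coe_ne_top γ), ← EReal.exp_le_exp_iff, ENNReal.exp_log,
    ← EReal.coe_mul, EReal.exp_coe, mul_comm]
  exact ENNReal.le_tsum n

variable [MeasurableSpace Ω] {ξ}

lemma measurable_walk (hmeas : ∀ n, Measurable (ξ n)) (n : ℕ) : Measurable (walk ξ n) := by
  unfold walk
  fun_prop

lemma measurable_runMax (hmeas : ∀ n, Measurable (ξ n)) (n : ℕ) : Measurable (runMax ξ n) := by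
  refine measurable_of_Ioi fun x => ?_
  have : runMax ξ n ⁻¹' Ioi x = ⋃ i, ⋃ (_ : i ≤ n), walk ξ i ⁻¹' Ioi x := by
    ext ω
    simp [lt_runMax_iff]
  rw [this]
  exact .iUnion fun i => .iUnion fun _ => measurable_walk hmeas i measurableSet_Ioi

lemma measurable_globalMax (hmeas : ∀ n, Measurable (ξ n)) : Measurable (globalMax ξ) := by
  unfold globalMax
  exact .iSup fun n => (measurable_walk hmeas n).coe_real_ereal

end Paths

/-! ### Independence, shift invariance and the recursion in law. -/

section Law

variable {Ω : Type*} {ξ : ℕ → Ω → ℝ}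

open Classical in
/-- The sequence with the entries outside `S` replaced by `0`. -/
noncomputable def restrictSeq (S : Set ℕ) (ξ : ℕ → Ω → ℝ) (ω : Ω) (i : ℕ) : ℝ :=
  if i ∈ S then ξ i ω else 0

lemma restrictSeq_of_mem {S : Set ℕ} {i : ℕ} (h : i ∈ S) (ω : Ω) :
    restrictSeq S ξ ω i = ξ i ω := if_pos h

/-- The real valued version of the maximum of the random walk. -/
noncomputable def realMax (ξ : ℕ → Ω → ℝ) (ω : Ω) : ℝ := (globalMax ξ ω).toReal

lemma coe_realMax {ω : Ω} (h : globalMax ξ ω ≠ ⊤) : (realMax ξ ω : EReal) = globalMax ξ ω :=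
  EReal.coe_toReal h (ne_bot_of_le_ne_bot EReal.zero_ne_bot (globalMax_nonneg ξ ω))

variable [MeasurableSpace Ω] {P : Measure Ω} {F : Measure ℝ}

/-- Both blocks remain sequences indexed by `ℕ`, so functionals of the path can be composed with
them directly. -/
lemma indepFun_restrictSeq (hmeas : ∀ n, Measurable (ξ n)) (hindep : iIndepFun ξ P)
    {S T : Set ℕ} (hST : Disjoint S T) :
    IndepFun (restrictSeq S ξ) (restrictSeq T ξ) P := by
  have key : ∀ S : Set ℕ, MeasurableSpace.comap (restrictSeq S ξ) inferInstance
      ≤ ⨆ i ∈ S, MeasurableSpace.comap (ξ i) inferInstance := by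
    intro S
    rw [← measurable_iff_comap_le]
    refine @measurable_pi_lambda _ _ _ (_) _ _ fun i => ?_
    by_cases hi : i ∈ S
    · have : (fun ω => restrictSeq S ξ ω i) = ξ i := funext fun ω => restrictSeq_of_mem hi ω
      rw [this]
      exact measurable_iff_comap_le.2 (le_iSup₂_of_le i hi le_rfl)
    · have : (fun ω => restrictSeq S ξ ω i) = fun _ => 0 := funext fun ω => if_neg hi
      rw [this]
      exact measurable_const
  rw [IndepFun_iff_Indep]
  exact indep_of_indep_of_le_left (indep_of_indep_of_le_right
    (indep_iSup_of_disjoint (fun i => (hmeas i).comap_le) hindep.iIndep hST) (key T)) (key S)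

/-- Both laws are the infinite product of copies of `F`. -/
lemma map_shift_eq (hmeas : ∀ n, Measurable (ξ n)) (hlaw : ∀ n, P.map (ξ n) = F)
    (hindep : iIndepFun ξ P) (k : ℕ) :
    P.map (fun ω i => ξ (k + i) ω) = P.map (fun ω i => ξ i ω) := by
  rw [hindep.map_fun_eq_infinitePi_map hmeas, iIndepFun.map_fun_eq_infinitePi_map
    (X := fun i => ξ (k + i)) (fun i => hmeas _) (hindep.precomp (add_right_injective k))]
  simp_rw [hlaw]

lemma measurable_realMax (hmeas : ∀ n, Measurable (ξ n)) : Measurable (realMax ξ) :=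
  (measurable_globalMax hmeas).ereal_toReal

lemma map_globalMax_shift (hmeas : ∀ n, Measurable (ξ n)) (hlaw : ∀ n, P.map (ξ n) = F)
    (hindep : iIndepFun ξ P) (k : ℕ) :
    P.map (globalMax fun i => ξ (k + i)) = P.map (globalMax ξ) := by
  have hm : Measurable (globalMax fun i (s : ℕ → ℝ) => s i) :=
    measurable_globalMax fun n => measurable_pi_apply n
  have := congrArg (Measure.map (globalMax fun i (s : ℕ → ℝ) => s i))
    (map_shift_eq hmeas hlaw hindep k)
  rwa [Measure.map_map hm (measurable_pi_lambda _ fun i => hmeas _),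
    Measure.map_map hm (measurable_pi_lambda _ fun i => hmeas _)] at this

lemma map_runMax_shift (hmeas : ∀ n, Measurable (ξ n)) (hlaw : ∀ n, P.map (ξ n) = F)
    (hindep : iIndepFun ξ P) (k n : ℕ) :
    P.map (runMax (fun i => ξ (k + i)) n) = P.map (runMax ξ n) := by
  have hm : Measurable (runMax (fun i (s : ℕ → ℝ) => s i) n) :=
    measurable_runMax (fun n => measurable_pi_apply n) n
  have := congrArg (Measure.map (runMax (fun i (s : ℕ → ℝ) => s i) n))
    (map_shift_eq hmeas hlaw hindep k)
  rwa [Measure.map_map hm (measurable_pi_lambda _ fun i => hmeas _),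
    Measure.map_map hm (measurable_pi_lambda _ fun i => hmeas _)] at this

lemma indepFun_runMax_shift (hmeas : ∀ n, Measurable (ξ n)) (hindep : iIndepFun ξ P) (n : ℕ) :
    IndepFun (runMax (fun i => ξ (i + 1)) n) (ξ 0) P := by
  have hψ : Measurable fun s : ℕ → ℝ => s 0 := measurable_pi_apply 0
  have h := (indepFun_restrictSeq hmeas hindep
    (disjoint_compl_left (a := ({0} : Set ℕ)))).comp
    (φ := runMax (fun i (s : ℕ → ℝ) => s (i + 1)) n)
    (measurable_runMax (fun i => measurable_pi_apply _) n) hψ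
  convert h using 1
  · ext ω
    -- The two sides are functionals on different spaces; freezing `ω` turns each into a path over
    -- `Unit`, where they can be compared.
    refine (runMax_congr (Ω := Unit) (ξ := fun i _ => ξ (i + 1) ω)
      (ξ' := fun i _ => restrictSeq _ ξ ω (i + 1)) (n := n) (ω := ()) fun i _ => ?_)
    exact (restrictSeq_of_mem (by simp) ω).symm
  · ext ω
    exact (restrictSeq_of_mem rfl ω).symm

lemma tail_map {X : Ω → ℝ} (hX : Measurable X) (x : ℝ) :
    tail (P.map X) x = P.real {ω | x < X ω} := by
  unfold tail
  rw [map_measureReal_apply hX measurableSet_Ioi]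
  rfl

lemma tail_map_runMax_succ [IsProbabilityMeasure P]
    (hmeas : ∀ n, Measurable (ξ n)) (hlaw : ∀ n, P.map (ξ n) = F)
    (hindep : iIndepFun ξ P) (n : ℕ) {x : ℝ} (hx : 0 ≤ x) :
    tail (P.map (runMax ξ (n + 1))) x = tail (Measure.conv (P.map (runMax ξ n)) F) x := by
  have h1 : P.map (runMax (fun i => ξ (i + 1)) n) = P.map (runMax ξ n) := by
    simpa only [add_comm] using map_runMax_shift hmeas hlaw hindep 1 n
  have hm := measurable_runMax (ξ := fun i => ξ (i + 1)) (fun i => hmeas _) n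
  rw [← h1, ← hlaw 0, ← (indepFun_runMax_shift hmeas hindep n).map_add_eq_map_conv_map
    hm (hmeas 0), tail_map (measurable_runMax hmeas _), tail_map (hm.add (hmeas 0))]
  congr 1
  ext ω
  exact lt_runMax_succ_iff ξ n hx ω

lemma tendsto_tail_map_runMax [IsProbabilityMeasure P] (hmeas : ∀ n, Measurable (ξ n)) (x : ℝ) :
    Tendsto (fun n => tail (P.map (runMax ξ n)) x) atTop
      (𝓝 (P.real {ω | (x : EReal) < globalMax ξ ω})) := by
  have hmono : Monotone fun n => {ω | x < runMax ξ n ω} := by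
    intro n k hnk ω hω
    obtain ⟨i, hi, h⟩ := (lt_runMax_iff ξ n x ω).1 hω
    exact (lt_runMax_iff ξ k x ω).2 ⟨i, hi.trans hnk, h⟩
  have h := tendsto_measure_iUnion_atTop (μ := P) hmono
  have he : (⋃ n, {ω | x < runMax ξ n ω}) = {ω | (x : EReal) < globalMax ξ ω} := by
    ext ω
    simp only [mem_iUnion, mem_ofPred_eq, lt_runMax_iff, lt_globalMax_iff]
    exact ⟨fun ⟨n, i, _, h⟩ => ⟨i, h⟩, fun ⟨i, h⟩ => ⟨i, i, le_rfl, h⟩⟩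
  rw [he] at h
  simp_rw [tail_map (measurable_runMax hmeas _)]
  exact (ENNReal.tendsto_toReal (measure_ne_top _ _)).comp h

end Law

/-! ### Exponential moment of the maximum and the upper bound. -/

section Moments

variable {Ω : Type*} [MeasurableSpace Ω] {P : Measure Ω}
  {F : Measure ℝ} {ξ : ℕ → Ω → ℝ} {γ : ℝ}

lemma integrable_exp_mul_walk [IsProbabilityMeasure P]
    (hmeas : ∀ n, Measurable (ξ n)) (hlaw : ∀ n, P.map (ξ n) = F)
    (hindep : iIndepFun ξ P) (hF : expMoment F γ < ∞) (n : ℕ) :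
    Integrable (fun ω => Real.exp (γ * walk ξ n ω)) P := by
  have h := hindep.integrable_exp_mul_sum hmeas (s := Finset.range n) (t := γ) fun i _ => by
    have := integrable_exp_of_expMoment_lt_top hF
    rw [← hlaw i] at this
    exact this.comp_measurable (hmeas i)
  simpa only [walk, Finset.sum_apply] using h

lemma integral_exp_mul_walk (hmeas : ∀ n, Measurable (ξ n)) (hlaw : ∀ n, P.map (ξ n) = F)
    (hindep : iIndepFun ξ P) (n : ℕ) :
    ∫ ω, Real.exp (γ * walk ξ n ω) ∂P = (expMoment F γ).toReal ^ n := by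
  have h := hindep.mgf_sum hmeas (Finset.range n) (t := γ)
  have h1 : ∀ i, mgf (ξ i) P γ = (expMoment F γ).toReal := fun i => by
    rw [toReal_expMoment, ← hlaw i, mgf, integral_map (hmeas i).aemeasurable (by fun_prop)]
  simp_rw [h1, Finset.prod_const, Finset.card_range] at h
  rw [← h]
  simp [mgf, walk]

/-- The moment is dominated by `∑ E e^{γ S_n} = ∑ φ^n`, a convergent geometric series. -/
lemma expMax_lt_top [IsProbabilityMeasure P] (hγ : 0 < γ)
    (hmeas : ∀ n, Measurable (ξ n)) (hlaw : ∀ n, P.map (ξ n) = F)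
    (hindep : iIndepFun ξ P) (hφ : expMoment F γ < 1) : expMax P ξ γ < ∞ := by
  have hF : expMoment F γ < ∞ := hφ.trans ENNReal.one_lt_top
  calc expMax P ξ γ ≤ ∫⁻ ω, ∑' n, ENNReal.ofReal (Real.exp (γ * walk ξ n ω)) ∂P :=
        lintegral_mono fun ω => exp_mul_globalMax_le ξ hγ ω
    _ = ∑' n, ∫⁻ ω, ENNReal.ofReal (Real.exp (γ * walk ξ n ω)) ∂P := by
        refine lintegral_tsum fun n => ?_
        have := measurable_walk hmeas n
        fun_prop
    _ = ∑' n, expMoment F γ ^ n := by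
        refine tsum_congr fun n => ?_
        rw [← ofReal_integral_eq_lintegral_ofReal (integrable_exp_mul_walk hmeas hlaw hindep hF n)
          (ae_of_all _ fun _ => (Real.exp_pos _).le), integral_exp_mul_walk hmeas hlaw hindep,
          ENNReal.ofReal_pow ENNReal.toReal_nonneg, ENNReal.ofReal_toReal hF.ne]
    _ < ∞ := by
        rw [ENNReal.tsum_geometric, ENNReal.inv_lt_top]
        exact tsub_pos_of_lt hφ

lemma ae_globalMax_ne_top (hγ : 0 < γ) (hmeas : ∀ n, Measurable (ξ n))
    (h : expMax P ξ γ < ∞) : ∀ᵐ ω ∂P, globalMax ξ ω ≠ ⊤ := by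
  by_contra hcon
  have h1 : P {ω | globalMax ξ ω = ⊤} ≠ 0 := by
    intro h0
    exact hcon (by simpa [ae_iff] using h0)
  refine h.ne (eq_top_iff.2 ?_)
  calc ∞ = ∫⁻ ω in {ω | globalMax ξ ω = ⊤}, ∞ ∂P := by
        rw [setLIntegral_const, ENNReal.top_mul h1]
    _ = ∫⁻ ω in {ω | globalMax ξ ω = ⊤}, EReal.exp ((γ : EReal) * globalMax ξ ω) ∂P := by
        refine setLIntegral_congr_fun (measurable_globalMax hmeas (measurableSet_singleton ⊤))
          fun ω hω => ?_
        have hω' : globalMax ξ ω = ⊤ := hω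
        simp [hω', EReal.coe_mul_top_of_pos hγ]
    _ ≤ _ := setLIntegral_le_lintegral _ _

lemma expMax_eq_lintegral_realMax (hγ : 0 < γ) (hmeas : ∀ n, Measurable (ξ n))
    (h : expMax P ξ γ < ∞) :
    expMax P ξ γ = ∫⁻ ω, ENNReal.ofReal (Real.exp (γ * realMax ξ ω)) ∂P := by
  refine lintegral_congr_ae ?_
  filter_upwards [ae_globalMax_ne_top hγ hmeas h] with ω hω
  rw [← coe_realMax hω, ← EReal.coe_mul, EReal.exp_coe]

lemma expMoment_map_realMax (hγ : 0 < γ) (hmeas : ∀ n, Measurable (ξ n))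
    (h : expMax P ξ γ < ∞) : expMoment (P.map (realMax ξ)) γ = expMax P ξ γ := by
  rw [expMoment, lintegral_map (by fun_prop) (measurable_realMax hmeas),
    expMax_eq_lintegral_realMax hγ hmeas h]

lemma map_realMax_shift (hmeas : ∀ n, Measurable (ξ n)) (hlaw : ∀ n, P.map (ξ n) = F)
    (hindep : iIndepFun ξ P) (k : ℕ) :
    P.map (realMax fun i => ξ (k + i)) = P.map (realMax ξ) := by
  have := congrArg (Measure.map EReal.toReal) (map_globalMax_shift hmeas hlaw hindep k)
  rwa [Measure.map_map measurable_ereal_toReal (measurable_globalMax hmeas),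
    Measure.map_map measurable_ereal_toReal (measurable_globalMax fun i => hmeas _)] at this

lemma tail_map_realMax (hγ : 0 < γ) (hmeas : ∀ n, Measurable (ξ n)) (h : expMax P ξ γ < ∞)
    (x : ℝ) : tail (P.map (realMax ξ)) x = P.real {ω | (x : EReal) < globalMax ξ ω} := by
  rw [tail_map (measurable_realMax hmeas)]
  refine measureReal_congr ?_
  filter_upwards [ae_globalMax_ne_top hγ hmeas h] with ω hω
  refine propext ?_
  change x < realMax ξ ω ↔ (x : EReal) < globalMax ξ ω
  rw [← coe_realMax hω, EReal.coe_lt_coe_iff]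

/-- The upper half of the tail asymptotics of the maximum. -/
lemma ClassS.eventually_measureReal_globalMax_lt [IsProbabilityMeasure P]
    [IsProbabilityMeasure F] (hγ : 0 < γ)
    (hmeas : ∀ n, Measurable (ξ n)) (hlaw : ∀ n, P.map (ξ n) = F) (hindep : iIndepFun ξ P)
    (hS : ClassS γ F) (hφ : expMoment F γ < 1) {c : ℝ}
    (hc : (expMax P ξ γ).toReal / (1 - (expMoment F γ).toReal) < c) :
    ∀ᶠ x : ℝ in atTop, P.real {ω | (x : EReal) < globalMax ξ ω} < c * tail F x := by
  have hM := expMax_lt_top hγ hmeas hlaw hindep hφ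
  have hG : IsProbabilityMeasure (P.map (realMax ξ)) :=
    Measure.isProbabilityMeasure_map (measurable_realMax hmeas).aemeasurable
  have hGn : ∀ n, IsProbabilityMeasure (P.map (runMax ξ n)) := fun n =>
    Measure.isProbabilityMeasure_map (measurable_runMax hmeas n).aemeasurable
  have hlim : ∀ x, Tendsto (fun n => tail (P.map (runMax ξ n)) x) atTop
      (𝓝 (tail (P.map (realMax ξ)) x)) := fun x => by
    rw [tail_map_realMax hγ hmeas hM]
    exact tendsto_tail_map_runMax hmeas x
  obtain ⟨B, hB0, hB⟩ := hS.exists_tail_le_of_recursion hφ (fun n => P.map (runMax ξ n))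
    (fun x hx => by
      rw [tail_map (measurable_runMax hmeas 0)]
      have : {ω | x < runMax ξ 0 ω} = ∅ := by
        ext ω
        simp [lt_runMax_iff, hx]
      rw [this, measureReal_empty])
    (fun n x hx => tail_map_runMax_succ hmeas hlaw hindep n hx)
  have hfix : ∀ x, 0 ≤ x → tail (P.map (realMax ξ)) x
      = tail (Measure.conv (P.map (realMax ξ)) F) x := by
    intro x hx
    refine tendsto_nhds_unique ((tendsto_add_atTop_iff_nat 1).2 (hlim x)) ?_
    -- With the order of convolution swapped, `n` enters only through the integrand and the
    -- integrating measure `F` is fixed, so dominated convergence applies.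
    simp_rw [tail_map_runMax_succ hmeas hlaw hindep _ hx, Measure.conv_comm _ F,
      tail_conv_eq_integral]
    refine tendsto_integral_of_dominated_convergence (fun _ => 1)
      (fun n => (integrable_tail_comp F _ (by fun_prop)).aestronglyMeasurable)
      (integrable_const _) (fun n => ae_of_all _ fun y => ?_) (ae_of_all _ fun y => hlim _)
    rw [Real.norm_of_nonneg (tail_nonneg _ _)]
    exact tail_le_one _ _
  have hE := expMoment_map_realMax hγ hmeas hM
  have := hS.eventually_tail_lt_of_fixedPoint hφ hfix hB0
    (fun x hx => le_of_tendsto' (hlim x) fun n => hB n x hx)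
    (integrable_exp_of_expMoment_lt_top (hE.trans_lt hM)) (c := c)
    (by rwa [← toReal_expMoment, hE])
  simpa only [tail_map_realMax hγ hmeas hM] using this

end Moments

/-! ### Lower bound: one big jump. -/

section LowerBound

variable {Ω : Type*} {ξ : ℕ → Ω → ℝ}

/-- After `S_n > b ≥ a`, no later running maximum can be at most `a`. -/
lemma jumpEvent_disjoint {n k : ℕ} (hnk : n < k) {a b : ℝ} (hab : a ≤ b) :
    Disjoint (jumpEvent ξ n a b) (jumpEvent ξ k a b) := by
  rw [Set.disjoint_left]
  rintro ω ⟨_, h1⟩ ⟨h2, _⟩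
  exact absurd ((runMax_le_iff ξ _ _ ω).1 h2 n (by omega)) (by linarith)

/-- What is independent of `ξ n`: the past maximum, the past position, the future maximum. -/
noncomputable def pastFuture (ξ : ℕ → Ω → ℝ) (n : ℕ) (ω : Ω) : ℝ × ℝ × ℝ :=
  (runMax ξ n ω, walk ξ n ω, realMax (fun i => ξ (n + 1 + i)) ω)

/-- Past and future maximum bounded by `K`. -/
def boundedPart (K : ℝ) : Set (ℝ × ℝ × ℝ) := {p | p.1 ≤ K ∧ p.2.2 ≤ K}

lemma measurableSet_boundedPart (K : ℝ) : MeasurableSet (boundedPart K) :=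
  (measurableSet_le measurable_fst measurable_const).inter
    (measurableSet_le measurable_snd.snd measurable_const)

lemma lt_globalMax_of_pastFuture {n : ℕ} {x : ℝ} {ω : Ω}
    (h : x < (pastFuture ξ n ω).2.1 + (pastFuture ξ n ω).2.2 + ξ n ω) :
    (x : EReal) < globalMax ξ ω := by
  have h1 : x - walk ξ (n + 1) ω < realMax (fun i => ξ (n + 1 + i)) ω := by
    rw [walk_succ]
    simp only [pastFuture] at h
    linarith
  -- An infinite future maximum has `toReal` equal to `0`, so the inequality holds for every `ω`,
  -- not only almost surely.
  have h2 : ((x - walk ξ (n + 1) ω : ℝ) : EReal) < globalMax (fun i => ξ (n + 1 + i)) ω :=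
    (EReal.coe_lt_coe_iff.2 h1).trans_le (EReal.coe_toReal_le
      (ne_bot_of_le_ne_bot EReal.zero_ne_bot (globalMax_nonneg _ ω)))
  obtain ⟨k, hk⟩ := (lt_globalMax_iff _ _ _).1 h2
  refine (lt_globalMax_iff _ _ _).2 ⟨n + 1 + k, ?_⟩
  rw [walk_add]
  linarith

lemma mem_jumpEvent_of_pastFuture {n : ℕ} {x K a : ℝ} {ω : Ω} (hKa : K ≤ a)
    (hb : pastFuture ξ n ω ∈ boundedPart K)
    (h : x < (pastFuture ξ n ω).2.1 + (pastFuture ξ n ω).2.2 + ξ n ω) :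
    ω ∈ jumpEvent ξ (n + 1) a (x - a) := by
  obtain ⟨h1, h2⟩ := hb
  refine ⟨h1.trans hKa, ?_⟩
  rw [walk_succ]
  simp only [pastFuture] at h h2
  linarith

variable [MeasurableSpace Ω] {P : Measure Ω} {F : Measure ℝ} {γ : ℝ}

lemma measurable_pastFuture (hmeas : ∀ n, Measurable (ξ n)) (n : ℕ) :
    Measurable (pastFuture ξ n) :=
  (measurable_runMax hmeas n).prodMk
    ((measurable_walk hmeas n).prodMk (measurable_realMax fun _ => hmeas _))

/-- The triple depends only on increments with index different from `n`. -/
lemma indepFun_pastFuture (hmeas : ∀ n, Measurable (ξ n)) (hindep : iIndepFun ξ P) (n : ℕ) :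
    IndepFun (pastFuture ξ n) (ξ n) P := by
  have hψ : Measurable fun s : ℕ → ℝ => s n := measurable_pi_apply n
  have h := (indepFun_restrictSeq hmeas hindep
    (disjoint_compl_left (a := ({n} : Set ℕ)))).comp
    (φ := pastFuture (fun i (s : ℕ → ℝ) => s i) n)
    (measurable_pastFuture (fun i => measurable_pi_apply i) n) hψ
  have e1 : pastFuture (fun i (s : ℕ → ℝ) => s i) n ∘ restrictSeq {n}ᶜ ξ = pastFuture ξ n := by
    ext1 ω
    have hlt : ∀ i < n, restrictSeq {n}ᶜ ξ ω i = ξ i ω := fun i hi =>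
      restrictSeq_of_mem (by simp [hi.ne]) ω
    have hgt : ∀ i, restrictSeq {n}ᶜ ξ ω (n + 1 + i) = ξ (n + 1 + i) ω := fun i =>
      restrictSeq_of_mem (by simp; omega) ω
    refine Prod.ext ?_ (Prod.ext ?_ ?_)
    · exact runMax_congr (Ω := Unit) (ξ := fun i _ => restrictSeq {n}ᶜ ξ ω i)
        (ξ' := fun i _ => ξ i ω) (ω := ()) hlt
    · exact walk_congr (Ω := Unit) (ξ := fun i _ => restrictSeq {n}ᶜ ξ ω i)
        (ξ' := fun i _ => ξ i ω) (ω := ()) hlt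
    · exact congrArg EReal.toReal (globalMax_congr (Ω := Unit)
        (ξ := fun i _ => restrictSeq {n}ᶜ ξ ω (n + 1 + i))
        (ξ' := fun i _ => ξ (n + 1 + i) ω) (ω := ()) hgt)
  have e2 : (fun s : ℕ → ℝ => s n) ∘ restrictSeq {n} ξ = ξ n := by
    ext1 ω
    exact restrictSeq_of_mem rfl ω
  rwa [e1, e2] at h

lemma indepFun_walk_realMax (hmeas : ∀ n, Measurable (ξ n)) (hindep : iIndepFun ξ P) (n : ℕ) :
    IndepFun (walk ξ n) (realMax fun i => ξ (n + 1 + i)) P := by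
  have hST : Disjoint (Iio n) (Ioi n) :=
    Set.disjoint_left.2 fun _ hi hi' => lt_asymm (mem_Iio.1 hi) (mem_Ioi.1 hi')
  have h := (indepFun_restrictSeq hmeas hindep hST).comp
    (φ := walk (fun i (s : ℕ → ℝ) => s i) n)
    (ψ := realMax fun i (s : ℕ → ℝ) => s (n + 1 + i))
    (measurable_walk (fun i => measurable_pi_apply i) n)
    (measurable_realMax fun i => measurable_pi_apply _)
  have e1 : walk (fun i (s : ℕ → ℝ) => s i) n ∘ restrictSeq (Iio n) ξ = walk ξ n := by
    ext1 ω
    exact walk_congr (Ω := Unit) (ξ := fun i _ => restrictSeq (Iio n) ξ ω i)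
      (ξ' := fun i _ => ξ i ω) (ω := ()) fun i hi => restrictSeq_of_mem (mem_Iio.2 hi) ω
  have e2 : (realMax fun i (s : ℕ → ℝ) => s (n + 1 + i)) ∘ restrictSeq (Ioi n) ξ
      = realMax fun i => ξ (n + 1 + i) := by
    ext1 ω
    exact congrArg EReal.toReal (globalMax_congr (Ω := Unit)
        (ξ := fun i _ => restrictSeq (Ioi n) ξ ω (n + 1 + i))
        (ξ' := fun i _ => ξ (n + 1 + i) ω) (ω := ())
        fun i => restrictSeq_of_mem (mem_Ioi.2 (by omega)) ω)
  rwa [e1, e2] at h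

variable [IsProbabilityMeasure P]

lemma measureReal_mem_and_lt_add [IsProbabilityMeasure F] {β : Type*} [MeasurableSpace β]
    {Z : Ω → β} {Y : Ω → ℝ}
    (hZ : Measurable Z) (hY : Measurable Y) (hlaw : P.map Y = F) (hZY : IndepFun Z Y P)
    {s : Set β} (hs : MeasurableSet s) {w : β → ℝ} (hw : Measurable w) (x : ℝ) :
    P.real {ω | Z ω ∈ s ∧ x < w (Z ω) + Y ω} = ∫ z in s, tail F (x - w z) ∂(P.map Z) := by
  have hA : MeasurableSet {p : β × ℝ | p.1 ∈ s ∧ x < w p.1 + p.2} :=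
    (measurable_fst hs).inter
      (measurableSet_lt measurable_const ((hw.comp measurable_fst).add measurable_snd))
  have h1 : P {ω | Z ω ∈ s ∧ x < w (Z ω) + Y ω}
      = ∫⁻ z in s, F (Ioi (x - w z)) ∂(P.map Z) := by
    have h2 := Measure.map_apply (μ := P) (hZ.prodMk hY) hA
    rw [(indepFun_iff_map_prod_eq_prod_map_map hZ.aemeasurable hY.aemeasurable).1 hZY, hlaw,
      Measure.prod_apply hA] at h2
    rw [← lintegral_indicator hs]
    refine h2.symm.trans (lintegral_congr fun z => ?_)
    by_cases hz : z ∈ s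
    · rw [indicator_of_mem hz]
      congr 1
      ext y
      simp [hz, sub_lt_iff_lt_add']
    · rw [indicator_of_notMem hz]
      convert measure_empty (μ := F)
      ext y
      simp [hz]
  unfold tail Measure.real
  rw [integral_toReal, h1]
  · exact (measurable_measure_Ioi F (by fun_prop)).aemeasurable
  · exact ae_of_all _ fun z => measure_lt_top _ _

/-- `S_n` and the future maximum use disjoint blocks of increments, and the latter has the law of
`M`, so the expectation factors. -/
lemma integrable_exp_pastFuture (hγ : 0 < γ)
    (hmeas : ∀ n, Measurable (ξ n)) (hlaw : ∀ n, P.map (ξ n) = F) (hindep : iIndepFun ξ P)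
    (hφ : expMoment F γ < 1) (n : ℕ) :
    Integrable (fun p : ℝ × ℝ × ℝ => Real.exp (γ * (p.2.1 + p.2.2))) (P.map (pastFuture ξ n)) ∧
    ∫ p, Real.exp (γ * (p.2.1 + p.2.2)) ∂(P.map (pastFuture ξ n))
      = (expMoment F γ).toReal ^ n * (expMax P ξ γ).toReal := by
  have hF : expMoment F γ < ∞ := hφ.trans ENNReal.one_lt_top
  have hM := expMax_lt_top hγ hmeas hlaw hindep hφ
  have hm : Measurable (realMax fun i => ξ (n + 1 + i)) := measurable_realMax fun i => hmeas _
  have hE := expMoment_map_realMax hγ hmeas hM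
  rw [← map_realMax_shift hmeas hlaw hindep (n + 1)] at hE
  have hi : Integrable (fun ω => Real.exp (γ * realMax (fun i => ξ (n + 1 + i)) ω)) P :=
    (integrable_exp_of_expMoment_lt_top (hE.trans_lt hM)).comp_measurable hm
  have hind : IndepFun (fun ω => Real.exp (γ * walk ξ n ω))
      (fun ω => Real.exp (γ * realMax (fun i => ξ (n + 1 + i)) ω)) P :=
    (indepFun_walk_realMax hmeas hindep n).comp (φ := fun y => Real.exp (γ * y))
      (ψ := fun y => Real.exp (γ * y)) (by fun_prop) (by fun_prop)
  have hw := integrable_exp_mul_walk hmeas hlaw hindep hF n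
  have e : ∀ ω, Real.exp (γ * ((pastFuture ξ n ω).2.1 + (pastFuture ξ n ω).2.2))
      = Real.exp (γ * walk ξ n ω) * Real.exp (γ * realMax (fun i => ξ (n + 1 + i)) ω) := by
    intro ω
    rw [← Real.exp_add, ← mul_add]
    rfl
  constructor
  · rw [integrable_map_measure (by fun_prop) (measurable_pastFuture hmeas n).aemeasurable]
    exact (hind.integrable_mul hw hi).congr (ae_of_all _ fun ω => (e ω).symm)
  · rw [integral_map (measurable_pastFuture hmeas n).aemeasurable (by fun_prop)]
    simp_rw [e]
    rw [hind.integral_fun_mul_eq_mul_integral hw.aestronglyMeasurable hi.aestronglyMeasurable,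
      integral_exp_mul_walk hmeas hlaw hindep, ← hE,
      toReal_expMoment γ (P.map _), integral_map hm.aemeasurable (by fun_prop)]

lemma tendsto_setIntegral_boundedPart (hγ : 0 < γ)
    (hmeas : ∀ n, Measurable (ξ n)) (hlaw : ∀ n, P.map (ξ n) = F) (hindep : iIndepFun ξ P)
    (hφ : expMoment F γ < 1) (n : ℕ) :
    Tendsto (fun K => ∫ p in boundedPart K,
        Real.exp (γ * (p.2.1 + p.2.2)) ∂(P.map (pastFuture ξ n))) atTop
      (𝓝 ((expMoment F γ).toReal ^ n * (expMax P ξ γ).toReal)) := by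
  obtain ⟨h1, h2⟩ := integrable_exp_pastFuture hγ hmeas hlaw hindep hφ n
  have hU : ⋃ K, boundedPart K = univ :=
    eq_univ_of_forall fun p => mem_iUnion.2 ⟨max p.1 p.2.2, le_max_left _ _, le_max_right _ _⟩
  have h := tendsto_setIntegral_of_monotone (μ := P.map (pastFuture ξ n))
    (f := fun p : ℝ × ℝ × ℝ => Real.exp (γ * (p.2.1 + p.2.2)))
    measurableSet_boundedPart (fun K L hKL p hp => ⟨hp.1.trans hKL, hp.2.trans hKL⟩)
    h1.integrableOn
  rwa [hU, setIntegral_univ, h2] at h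

/-- The lower half of the asymptotics, with one big jump. -/
lemma ClassS.eventually_lt_measureReal_someJump [IsProbabilityMeasure F] (hγ : 0 < γ)
    (hmeas : ∀ n, Measurable (ξ n)) (hlaw : ∀ n, P.map (ξ n) = F) (hindep : iIndepFun ξ P)
    (hS : ClassS γ F) (hφ : expMoment F γ < 1) {h : ℝ → ℝ} (hle : ∀ x, 0 < x → h x ≤ x / 2)
    (hlim : Tendsto h atTop atTop) {c : ℝ}
    (hc : c < (expMax P ξ γ).toReal / (1 - (expMoment F γ).toReal)) :
    ∀ᶠ x : ℝ in atTop, c * tail F x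
      < P.real ({ω | (x : EReal) < globalMax ξ ω} ∩ someJump ξ (h x) (x - h x)) := by
  have hφ' : (expMoment F γ).toReal < 1 := by
    simpa using (ENNReal.toReal_lt_toReal hφ.ne_top ENNReal.one_ne_top).2 hφ
  have hsum := (hasSum_geometric_of_lt_one ENNReal.toReal_nonneg hφ').mul_right
    (expMax P ξ γ).toReal
  rw [inv_mul_eq_div] at hsum
  -- `N` truncates the geometric series while keeping it above `c`; then `K` truncates the `N`
  -- expectations.
  obtain ⟨N, hN⟩ := (hsum.tendsto_sum_nat.eventually_const_lt hc).exists
  have hK := tendsto_finsetSum (Finset.range N) fun n _ =>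
    tendsto_setIntegral_boundedPart hγ hmeas hlaw hindep hφ n
  obtain ⟨K, hK⟩ := (hK.eventually_const_lt hN).exists
  let w : ℝ × ℝ × ℝ → ℝ := fun p => p.2.1 + p.2.2
  have hw : Measurable w := by fun_prop
  have hbd : ∀ n, ∀ᵐ p ∂(P.map (pastFuture ξ n)).restrict (boundedPart K), w p ≤ 2 * K := by
    intro n
    rw [ae_restrict_iff' (measurableSet_boundedPart K),
      ae_map_iff (measurable_pastFuture hmeas n).aemeasurable]
    · refine ae_of_all _ fun ω hω => ?_
      have h1 : walk ξ n ω ≤ K := (runMax_le_iff ξ n K ω).1 hω.1 n le_rfl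
      have h2 := hω.2
      simp only [pastFuture, w] at h2 ⊢
      linarith
    · exact (measurableSet_boundedPart K).imp (measurableSet_le hw measurable_const)
  have hx := tendsto_finsetSum (Finset.range N) fun n _ =>
    hS.tendsto_integral_tail ((P.map (pastFuture ξ n)).restrict (boundedPart K))
      hw.aemeasurable (hbd n)
  filter_upwards [hx.eventually_const_lt hK, hlim.eventually_ge_atTop K, eventually_gt_atTop 0]
    with x h1 h2 h3
  rw [← Finset.sum_div, lt_div_iff₀ (hS.tail_pos x)] at h1
  refine h1.trans_le ?_
  have hE : ∀ n, ∫ p in boundedPart K, tail F (x - w p) ∂(P.map (pastFuture ξ n))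
      = P.real {ω | pastFuture ξ n ω ∈ boundedPart K ∧ x < w (pastFuture ξ n ω) + ξ n ω} :=
    fun n => (measureReal_mem_and_lt_add (measurable_pastFuture hmeas n) (hmeas n) (hlaw n)
      (indepFun_pastFuture hmeas hindep n) (measurableSet_boundedPart K) hw x).symm
  simp_rw [hE]
  -- This is what makes the jump events disjoint, so that the sum of probabilities is the
  -- probability of a union.
  have hab : h x ≤ x - h x := by linarith [hle x h3]
  rw [← measureReal_biUnion_finset]
  · refine measureReal_mono (iUnion₂_subset fun n _ ω hω => ?_)
    exact ⟨lt_globalMax_of_pastFuture hω.2, mem_iUnion₂.2 ⟨n + 1, by omega,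
      mem_jumpEvent_of_pastFuture h2 hω.1 hω.2⟩⟩
  · intro n _ k _ hnk
    rcases lt_or_gt_of_ne hnk with hlt | hlt
    · exact (jumpEvent_disjoint (Nat.succ_lt_succ hlt) hab).mono
        (fun ω hω => mem_jumpEvent_of_pastFuture h2 hω.1 hω.2)
        (fun ω hω => mem_jumpEvent_of_pastFuture h2 hω.1 hω.2)
    · exact (jumpEvent_disjoint (Nat.succ_lt_succ hlt) hab).symm.mono
        (fun ω hω => mem_jumpEvent_of_pastFuture h2 hω.1 hω.2)
        (fun ω hω => mem_jumpEvent_of_pastFuture h2 hω.1 hω.2)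
  · intro n _
    have hp := measurable_pastFuture hmeas n
    exact (hp (measurableSet_boundedPart K)).inter
      (measurableSet_lt measurable_const ((hw.comp hp).add (hmeas n)))

end LowerBound

/-! ### Uniformity in `t`. -/

/-- **Pólya's theorem**: pointwise convergence of antitone functions is uniform when the limit
can be finely sampled at finitely many points. -/
lemma tendstoUniformlyOn_of_antitoneOn {α ι : Type*} [Preorder α] {S : Set α} {l : Filter ι}
    {f : ι → α → ℝ} {g : α → ℝ} (hf : ∀ᶠ i in l, AntitoneOn (f i) S) (hg : AntitoneOn g S)
    (hlim : ∀ t ∈ S, Tendsto (fun i => f i t) l (𝓝 (g t)))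
    (hfin : ∀ ε > 0, ∃ T : Set α, T.Finite ∧ T ⊆ S ∧
      ∀ t ∈ S, ∃ a ∈ T, ∃ b ∈ T, a ≤ t ∧ t ≤ b ∧ g a - g b < ε) :
    TendstoUniformlyOn f g l S := by
  rw [Metric.tendstoUniformlyOn_iff]
  intro ε hε
  obtain ⟨T, hT, hTS, hT'⟩ := hfin (ε / 2) (half_pos hε)
  have h : ∀ᶠ i in l, ∀ a ∈ T, dist (f i a) (g a) < ε / 2 :=
    (eventually_all_finite hT).2 fun a ha =>
      Metric.tendsto_nhds.1 (hlim a (hTS ha)) _ (half_pos hε)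
  filter_upwards [hf, h] with i hi h t ht
  obtain ⟨a, ha, b, hb, hat, htb, hab⟩ := hT' t ht
  have h1 := h a ha
  have h2 := h b hb
  have h3 := hi (hTS ha) ht hat
  have h4 := hi ht (hTS hb) htb
  have h5 := hg (hTS ha) ht hat
  have h6 := hg ht (hTS hb) htb
  rw [Real.dist_eq, abs_lt] at h1 h2 ⊢
  constructor <;> linarith

/-- `e^{-γ t}` as a real number, for `t` possibly infinite. -/
noncomputable def expNeg (γ : ℝ) (t : EReal) : ℝ := (EReal.exp (-((γ : EReal) * t))).toReal

lemma expNeg_coe (γ t : ℝ) : expNeg γ t = Real.exp (-(γ * t)) := by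
  rw [expNeg, ← EReal.coe_mul, ← EReal.coe_neg, EReal.exp_coe,
    ENNReal.toReal_ofReal (Real.exp_pos _).le]

lemma expNeg_top {γ : ℝ} (hγ : 0 < γ) : expNeg γ ⊤ = 0 := by
  simp [expNeg, EReal.coe_mul_top_of_pos hγ]

lemma eq_top_or_coe_of_mem_Icc {t₀ : ℝ} {t : EReal} (ht : t ∈ Icc (t₀ : EReal) ⊤) :
    t = ⊤ ∨ ∃ s : ℝ, t = s ∧ t₀ ≤ s := by
  induction t with
  | bot => exact absurd ht.1 (by simp)
  | top => exact Or.inl rfl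
  | coe s => exact Or.inr ⟨s, rfl, EReal.coe_le_coe_iff.1 ht.1⟩

lemma antitoneOn_expNeg {γ : ℝ} (hγ : 0 < γ) (t₀ : ℝ) :
    AntitoneOn (expNeg γ) (Icc (t₀ : EReal) ⊤) := by
  intro s hs t ht hst
  rcases eq_top_or_coe_of_mem_Icc ht with rfl | ⟨t, rfl, -⟩
  · rw [expNeg_top hγ]
    exact ENNReal.toReal_nonneg
  · rcases eq_top_or_coe_of_mem_Icc hs with rfl | ⟨s, rfl, -⟩
    · exact absurd hst (by simp)
    · rw [expNeg_coe, expNeg_coe]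
      have : s ≤ t := EReal.coe_le_coe_iff.1 hst
      gcongr

/-- The sample is the grid `t₀ + j δ`, `j ≤ J`, together with `∞`: `δ` makes each drop `e^{-γ(t₀ +
jδ)} (1 - e^{-γδ})` small, and `J` makes the remaining tail small. -/
lemma exists_finite_expNeg {γ : ℝ} (hγ : 0 < γ) {t₀ : ℝ} (ht₀ : 0 ≤ t₀) {ε : ℝ} (hε : 0 < ε) :
    ∃ T : Set EReal, T.Finite ∧ T ⊆ Icc (t₀ : EReal) ⊤ ∧ ∀ t ∈ Icc (t₀ : EReal) ⊤,
      ∃ a ∈ T, ∃ b ∈ T, a ≤ t ∧ t ≤ b ∧ expNeg γ a - expNeg γ b < ε := by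
  have hc : Tendsto (fun δ : ℝ => 1 - Real.exp (-(γ * δ))) (𝓝[>] 0) (𝓝 0) := by
    have : ContinuousAt (fun δ : ℝ => 1 - Real.exp (-(γ * δ))) 0 := by fun_prop
    simpa [ContinuousAt] using this.mono_left nhdsWithin_le_nhds
  obtain ⟨δ, hδε, hδ⟩ := ((hc.eventually_lt_const hε).and self_mem_nhdsWithin).exists
  have hδ : 0 < δ := hδ
  have hJ : Tendsto (fun J : ℕ => Real.exp (-(γ * (t₀ + J * δ)))) atTop (𝓝 0) := by
    refine Real.tendsto_exp_atBot.comp (tendsto_neg_atTop_atBot.comp ?_)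
    exact (tendsto_atTop_add_const_left _ _
      (tendsto_natCast_atTop_atTop.atTop_mul_const hδ)).const_mul_atTop hγ
  obtain ⟨J, hJ⟩ := (hJ.eventually_lt_const hε).exists
  let p : ℕ → EReal := fun j => ((t₀ + j * δ : ℝ) : EReal)
  have hp : ∀ j, p j ∈ Icc (t₀ : EReal) ⊤ := fun j =>
    ⟨EReal.coe_le_coe_iff.2 (le_add_of_nonneg_right (by positivity)), le_top⟩
  have hpT : ∀ j ≤ J, p j ∈ insert ⊤ (p '' Iic J) := fun j hj => Or.inr ⟨j, hj, rfl⟩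
  refine ⟨insert ⊤ (p '' Iic J), ((finite_Iic J).image p).insert _, ?_, fun t ht => ?_⟩
  · rintro _ (rfl | ⟨j, -, rfl⟩)
    · exact ⟨le_top, le_top⟩
    · exact hp j
  by_cases htJ : p J ≤ t
  · refine ⟨p J, hpT J le_rfl, ⊤, mem_insert _ _, htJ, le_top, ?_⟩
    rw [expNeg_top hγ, expNeg_coe, sub_zero]
    exact hJ
  · rcases eq_top_or_coe_of_mem_Icc ht with rfl | ⟨t, rfl, hts⟩
    · exact absurd le_top htJ
    have htJ' : t < t₀ + J * δ := EReal.coe_lt_coe_iff.1 (not_le.1 htJ)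
    have hq : 0 ≤ (t - t₀) / δ := div_nonneg (by linarith) hδ.le
    have h1 := Nat.floor_le hq
    have h2 := Nat.lt_floor_add_one ((t - t₀) / δ)
    rw [le_div_iff₀ hδ] at h1
    rw [div_lt_iff₀ hδ] at h2
    set j := ⌊(t - t₀) / δ⌋₊
    have hjJ : j < J := by
      have : (j : ℝ) * δ < J * δ := by linarith
      exact_mod_cast lt_of_mul_lt_mul_right this hδ.le
    refine ⟨p j, hpT j hjJ.le, p (j + 1), hpT _ hjJ,
      EReal.coe_le_coe_iff.2 (by linarith), EReal.coe_le_coe_iff.2 (by push_cast; linarith), ?_⟩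
    rw [expNeg_coe, expNeg_coe]
    have e : Real.exp (-(γ * (t₀ + ((j + 1 : ℕ) : ℝ) * δ)))
        = Real.exp (-(γ * (t₀ + j * δ))) * Real.exp (-(γ * δ)) := by
      rw [← Real.exp_add]
      push_cast
      ring_nf
    have h3 : Real.exp (-(γ * (t₀ + j * δ))) ≤ 1 := Real.exp_le_one_iff.2 (by
      have : 0 ≤ γ * (t₀ + j * δ) := by positivity
      linarith)
    have h4 : 0 ≤ 1 - Real.exp (-(γ * δ)) := sub_nonneg.2 (Real.exp_le_one_iff.2 (by
      have : 0 ≤ γ * δ := by positivity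
      linarith))
    rw [e]
    calc _ = Real.exp (-(γ * (t₀ + j * δ))) * (1 - Real.exp (-(γ * δ))) := by ring
      _ ≤ 1 * (1 - Real.exp (-(γ * δ))) := by gcongr
      _ < ε := by linarith

section Uniform

variable {Ω : Type*} [MeasurableSpace Ω] {P : Measure Ω} [IsProbabilityMeasure P]
  {F : Measure ℝ} {ξ : ℕ → Ω → ℝ} {γ C : ℝ}

lemma tendstoUniformlyOn_exceed (hγ : 0 < γ) (hF : ClassL γ F) (hC : 0 ≤ C)
    (hlim : Tendsto (fun x : ℝ => P.real {ω | (x : EReal) < globalMax ξ ω} / tail F x)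
      atTop (𝓝 C)) {t₀ : ℝ} (ht₀ : 0 ≤ t₀) :
    TendstoUniformlyOn (fun (x : ℝ) (t : EReal) =>
        P.real {ω | (x : EReal) + t < globalMax ξ ω} / tail F x)
      (fun t => C * expNeg γ t) atTop (Icc (t₀ : EReal) ⊤) := by
  refine tendstoUniformlyOn_of_antitoneOn (Eventually.of_forall fun x s _ t _ hst => ?_)
    (fun s hs t ht hst => mul_le_mul_of_nonneg_left (antitoneOn_expNeg hγ t₀ hs ht hst) hC)
    (fun t ht => ?_) fun ε hε => ?_
  · refine div_le_div_of_nonneg_right (measureReal_mono fun ω hω => ?_) (tail_nonneg F x)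
    exact (add_le_add_right hst (x : EReal)).trans_lt hω
  · rcases eq_top_or_coe_of_mem_Icc ht with rfl | ⟨t, rfl, -⟩
    · simp [expNeg_top hγ]
    -- `P(M > x + t) / F̄(x)` is the tail ratio at `x + t` times `F̄(x + t) / F̄(x)`, which tends to
    -- `e^{-γt}`.
    · have h1 := hlim.comp (tendsto_atTop_add_const_right atTop t tendsto_id)
      have h2 := h1.mul (hF.tendsto_ratio (-t))
      rw [expNeg_coe, ← mul_neg]
      refine h2.congr fun x => ?_
      have := hF.tail_pos (x + t)
      simp only [Function.comp_apply, id, sub_neg_eq_add, EReal.coe_add]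
      field_simp
  · have hC1 : 0 < C + 1 := by linarith
    obtain ⟨T, h1, h2, h3⟩ := exists_finite_expNeg hγ ht₀ (div_pos hε hC1)
    refine ⟨T, h1, h2, fun t ht => ?_⟩
    obtain ⟨a, ha, b, hb, hat, htb, hab⟩ := h3 t ht
    refine ⟨a, ha, b, hb, hat, htb, ?_⟩
    rw [lt_div_iff₀ hC1] at hab
    have := antitoneOn_expNeg hγ t₀ (h2 ha) (h2 hb) (hat.trans htb)
    nlinarith

lemma measurableSet_someJump (hmeas : ∀ n, Measurable (ξ n)) (a x : ℝ) :
    MeasurableSet (someJump ξ a x) :=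
  .iUnion fun n => .iUnion fun _ =>
    (measurableSet_le (measurable_runMax hmeas _) measurable_const).inter
      (measurableSet_lt measurable_const (measurable_walk hmeas n))

lemma measureReal_localEvent (hmeas : ∀ n, Measurable (ξ n)) (x : ℝ) {t : EReal} (ht : 0 ≤ t) :
    P.real (localEvent ξ x t) = P.real {ω | (x : EReal) < globalMax ξ ω}
      - P.real {ω | (x : EReal) + t < globalMax ξ ω} := by
  have h : localEvent ξ x t = {ω | (x : EReal) < globalMax ξ ω}
      \ {ω | (x : EReal) + t < globalMax ξ ω} := by
    ext ω
    exact and_congr_right fun _ => not_lt.symm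
  rw [h, measureReal_sdiff _ (measurableSet_lt measurable_const (measurable_globalMax hmeas))]
  exact fun ω hω => (le_add_of_nonneg_right ht).trans_lt hω

lemma tendstoUniformlyOn_localEvent (hγ : 0 < γ) (hmeas : ∀ n, Measurable (ξ n))
    (hF : ClassL γ F) (hC : 0 ≤ C)
    (hlim : Tendsto (fun x : ℝ => P.real {ω | (x : EReal) < globalMax ξ ω} / tail F x)
      atTop (𝓝 C)) {t₀ : ℝ} (ht₀ : 0 ≤ t₀) :
    TendstoUniformlyOn (fun (x : ℝ) (t : EReal) => P.real (localEvent ξ x t) / tail F x)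
      (fun t => C * (1 - expNeg γ t)) atTop (Icc (t₀ : EReal) ⊤) := by
  have h := (hlim.tendstoUniformlyOn_const (Icc (t₀ : EReal) ⊤)).sub
    (tendstoUniformlyOn_exceed hγ hF hC hlim ht₀)
  refine (h.congr (Eventually.of_forall fun x t ht => ?_)).congr_right fun t _ => ?_
  · have ht0 : (0 : EReal) ≤ t := le_trans (by exact_mod_cast ht₀) ht.1
    simp only [Pi.sub_apply]
    rw [measureReal_localEvent hmeas x ht0, sub_div]
  · simp only [Pi.sub_apply]
    ring

/-- The part of the local event outside `J x` lies in `{M > x} \ J x`, which does not depend on `t`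
and has probability `o(F̄(x))`. -/
lemma tendstoUniformlyOn_localEvent_inter {J : ℝ → Set Ω}
    (hJ : ∀ x, MeasurableSet (J x)) {g : EReal → ℝ} {S : Set EReal}
    (hlim : Tendsto (fun x : ℝ => P.real {ω | (x : EReal) < globalMax ξ ω} / tail F x)
      atTop (𝓝 C))
    (hlim' : Tendsto (fun x : ℝ => P.real ({ω | (x : EReal) < globalMax ξ ω} ∩ J x) / tail F x)
      atTop (𝓝 C))
    (h : TendstoUniformlyOn (fun (x : ℝ) (t : EReal) => P.real (localEvent ξ x t) / tail F x)
      g atTop S) :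
    TendstoUniformlyOn (fun (x : ℝ) (t : EReal) => P.real (localEvent ξ x t ∩ J x) / tail F x)
      g atTop S := by
  have hd := hlim.sub hlim'
  rw [sub_self] at hd
  rw [Metric.tendstoUniformlyOn_iff] at h ⊢
  intro ε hε
  filter_upwards [h _ (half_pos hε), hd.eventually_lt_const (half_pos hε)] with x h1 h2 t ht
  have h3 := h1 t ht
  have h4 : P.real (localEvent ξ x t \ J x) ≤ P.real ({ω | (x : EReal) < globalMax ξ ω} \ J x) :=
    measureReal_mono (sdiff_subset_sdiff_left fun ω hω => hω.1)
  have h5 := measureReal_inter_add_sdiff (μ := P) (s := localEvent ξ x t) (hJ x)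
  have h6 := measureReal_inter_add_sdiff (μ := P) (s := {ω | (x : EReal) < globalMax ξ ω}) (hJ x)
  have h7 : P.real (localEvent ξ x t) / tail F x - P.real (localEvent ξ x t ∩ J x) / tail F x
      ≤ P.real {ω | (x : EReal) < globalMax ξ ω} / tail F x
        - P.real ({ω | (x : EReal) < globalMax ξ ω} ∩ J x) / tail F x := by
    rw [← sub_div, ← sub_div]
    exact div_le_div_of_nonneg_right (by linarith) (tail_nonneg F x)
  have h8 : P.real (localEvent ξ x t ∩ J x) / tail F x ≤ P.real (localEvent ξ x t) / tail F x :=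
    div_le_div_of_nonneg_right (measureReal_mono inter_subset_left) (tail_nonneg F x)
  rw [Real.dist_eq, abs_lt] at h3 ⊢
  constructor <;> linarith

end Uniform

end BigJump

open BigJump

/-! ### Assembly of the two bounds. -/

theorem mainTheorem2 {Ω : Type*} [MeasurableSpace Ω] (P : Measure Ω) [IsProbabilityMeasure P]
    (F : Measure ℝ) [IsProbabilityMeasure F]
    (ξ : ℕ → Ω → ℝ) (hmeas : ∀ n, Measurable (ξ n)) (hlaw : ∀ n, P.map (ξ n) = F)
    (hindep : iIndepFun ξ P)
    (γ : ℝ) (hγ : 0 < γ) (hS : BigJump.ClassS γ F) (hφ : BigJump.expMoment F γ < 1)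
    (h : ℝ → ℝ) (hpos : ∀ x, 0 < x → 0 < h x) (hle : ∀ x, 0 < x → h x ≤ x / 2)
    (hlim : Tendsto h atTop atTop) :
    BigJump.expMax P ξ γ < ∞ ∧
    -- the two limits for each fixed real `t > 0`
    (∀ t : ℝ, 0 < t →
      Tendsto (fun x : ℝ =>
          P.real (BigJump.localEvent ξ x t ∩ BigJump.someJump ξ (h x) (x - h x))
            / BigJump.tail F x) atTop
        (𝓝 ((BigJump.expMax P ξ γ).toReal / (1 - (BigJump.expMoment F γ).toReal)
          * (1 - Real.exp (-(γ * t))))) ∧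
      Tendsto (fun x : ℝ => P.real (BigJump.localEvent ξ x t) / BigJump.tail F x) atTop
        (𝓝 ((BigJump.expMax P ξ γ).toReal / (1 - (BigJump.expMoment F γ).toReal)
          * (1 - Real.exp (-(γ * t)))))) ∧
    -- both limits are uniform in `t ∈ [t₀, ∞]`
    (∀ t₀ : ℝ, 0 < t₀ →
      TendstoUniformlyOn (fun (x : ℝ) (t : EReal) =>
          P.real (BigJump.localEvent ξ x t ∩ BigJump.someJump ξ (h x) (x - h x))
            / BigJump.tail F x)
        (fun t => (BigJump.expMax P ξ γ).toReal / (1 - (BigJump.expMoment F γ).toReal)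
          * (1 - (EReal.exp (-((γ : EReal) * t))).toReal))
        atTop (Icc (t₀ : EReal) ⊤) ∧
      TendstoUniformlyOn (fun (x : ℝ) (t : EReal) =>
          P.real (BigJump.localEvent ξ x t) / BigJump.tail F x)
        (fun t => (BigJump.expMax P ξ γ).toReal / (1 - (BigJump.expMoment F γ).toReal)
          * (1 - (EReal.exp (-((γ : EReal) * t))).toReal))
        atTop (Icc (t₀ : EReal) ⊤)) := by
  have hM := expMax_lt_top hγ hmeas hlaw hindep hφ
  have hφ' : (expMoment F γ).toReal < 1 := by
    simpa using (ENNReal.toReal_lt_toReal hφ.ne_top ENNReal.one_ne_top).2 hφ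
  have hC : 0 ≤ (expMax P ξ γ).toReal / (1 - (expMoment F γ).toReal) :=
    div_nonneg ENNReal.toReal_nonneg (by linarith)
  have hup := fun c hc => hS.eventually_measureReal_globalMax_lt (c := c) hγ hmeas hlaw hindep hφ hc
  have hlo := fun c hc => hS.eventually_lt_measureReal_someJump (c := c) hγ hmeas hlaw hindep hφ
    hle hlim hc
  have hle' : ∀ x : ℝ, P.real ({ω | (x : EReal) < globalMax ξ ω} ∩ someJump ξ (h x) (x - h x))
      ≤ P.real {ω | (x : EReal) < globalMax ξ ω} := fun x => measureReal_mono inter_subset_left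
  have hl1 : Tendsto (fun x : ℝ => P.real {ω | (x : EReal) < globalMax ξ ω} / tail F x) atTop
      (𝓝 ((expMax P ξ γ).toReal / (1 - (expMoment F γ).toReal))) := by
    refine tendsto_order.2 ⟨fun c hc => ?_, fun c hc => ?_⟩
    · filter_upwards [hlo c hc] with x hx
      exact (lt_div_iff₀ (hS.tail_pos x)).2 (hx.trans_le (hle' x))
    · filter_upwards [hup c hc] with x hx
      exact (div_lt_iff₀ (hS.tail_pos x)).2 hx
  have hl2 : Tendsto (fun x : ℝ => P.real ({ω | (x : EReal) < globalMax ξ ω}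
      ∩ someJump ξ (h x) (x - h x)) / tail F x) atTop
      (𝓝 ((expMax P ξ γ).toReal / (1 - (expMoment F γ).toReal))) := by
    refine tendsto_order.2 ⟨fun c hc => ?_, fun c hc => ?_⟩
    · filter_upwards [hlo c hc] with x hx
      exact (lt_div_iff₀ (hS.tail_pos x)).2 hx
    · filter_upwards [hup c hc] with x hx
      exact (div_lt_iff₀ (hS.tail_pos x)).2 ((hle' x).trans_lt hx)
  have hu1 := fun t₀ (ht₀ : (0 : ℝ) < t₀) =>
    tendstoUniformlyOn_localEvent hγ hmeas hS.toClassL hC hl1 ht₀.le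
  have hu2 := fun t₀ (ht₀ : (0 : ℝ) < t₀) => tendstoUniformlyOn_localEvent_inter
    (fun x => measurableSet_someJump hmeas (h x) (x - h x)) hl1 hl2 (hu1 t₀ ht₀)
  refine ⟨hM, fun t ht => ?_, fun t₀ ht₀ => ⟨hu2 t₀ ht₀, hu1 t₀ ht₀⟩⟩
  -- The limit at a fixed `t` is the uniform statement on `[t, ∞]` at its left endpoint.
  rw [← expNeg_coe]
  exact ⟨(hu2 t ht).tendsto_at ⟨le_rfl, le_top⟩, (hu1 t ht).tendsto_at ⟨le_rfl, le_top⟩⟩
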